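/- For $a\in\mathbb R^5$ (indices $0,\dots,4$, taken modulo $5$) let $\operatorname{circ}(a)$ be the circulant matrix with entries $\operatorname{circ}(a)_{ij}=a_{j-i}$. Let $$\mathsf{circCOP}_5=\{a\in\mathbb R^5:\ \operatorname{circ}(a)\text{ is symmetric and }\langle v,\operatorname{circ}(a)v\rangle\ge 0\text{ for all }v\in\mathbb R^5_+\}$$ be the cone of circulant copositive matrices, and let $\mathsf{circCP}_5=\operatorname{cone}\{v*v^{\mathsf R}: v\in\mathbb R^5_+\}$, where $(a*b)_k=\sum_j a_jb_{k-j}$ and $(v^{\mathsf R})_i=v_{-i}$. Recall that for a convex cone $C$ and $v\neq0$, the half-line $\mathbb R_+v\subseteq C$, where $\mathbb R_+=[0,\infty)$, is an extremal ray of $C$ (written $\mathbb R_+ v\in\operatorname{ext} C$) if $v=x+y$ with $x,y\in C$ implies $x,y\in\mathbb R_+v$. For $\theta\in\mathbb R$ put $$h_\theta=(1,-\cos\theta,\cos 2\theta,\cos 2\theta,-\cos\theta),\qquad h'_\theta=(1,\cos 2\theta,-\cos\theta,-\cos\theta,\cos 2\theta).$$ **Theorem.** The cone $\mathsf{circCOP}_5$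 is the dual cone of $\mathsf{circCP}_5$ in the space of symmetric vectors: $$\mathsf{circCOP}_5=\{a\in\mathbb R^5:\ a^{\mathsf R}=a,\ \langle a,x\rangle\ge0\text{ for all }x\in\mathsf{circCP}_5\}.$$ Its extremal rays are exactly the half-lines $$\operatorname{ext}\,\mathsf{circCOP}_5=\mathbb R_+\cdot\Big[\{(0,1,0,0,1),(0,0,1,1,0)\}\sqcup\{h_\theta:\theta\in[0,\pi/5]\}\sqcup\{h'_\theta:\theta\in[0,\pi/5]\}\Big],$$ where the three sets of generators are pairwise disjoint. For $\theta=0$ the first family gives the Horn matrix $$\operatorname{circ}(h_0)=\operatorname{circ}(1,-1,1,1,-1)=\begin{pmatrix}1&-1&1&1&-1\\-1&1&-1&1&1\\1&-1&1&-1&1\\1&1&-1&1&-1\\-1&1&1&-1&1\end{pmatrix}.$$ -/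

import Mathlib

namespace CircCone

/-- The circulant matrix of a vector, `circ(a)_{ij} = a_{(j - i) mod d}` (subtraction in `Fin d` is
modulo `d`), so that `a` is the first row. -/
def circ {d : ℕ} (a : Fin d → ℝ) : Matrix (Fin d) (Fin d) ℝ :=
  Matrix.of fun i j => a (j - i)

/-- The set of all circulant real `d × d` matrices. -/
def Circ (d : ℕ) : Set (Matrix (Fin d) (Fin d) ℝ) :=
  Set.range circ

/-- The cone of copositive matrices: real symmetric matrices with `⟨v, A v⟩ ≥ 0` for all entrywise
nonnegative `v`. -/
def COP (d : ℕ) : Set (Matrix (Fin d) (Fin d) ℝ) :=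
  {A | A.IsSymm ∧ ∀ v : Fin d → ℝ, (∀ i, 0 ≤ v i) → 0 ≤ v ⬝ᵥ A.mulVec v}

/-- The circulant copositive cone `circ⁻¹(Circ_d ∩ COP_d)`, a set of vectors. -/
def circCOP (d : ℕ) : Set (Fin d → ℝ) :=
  circ ⁻¹' (Circ d ∩ COP d)

/-- The reversal `(a^R)_i = a_{(-i) mod d}`. -/
def reversal {d : ℕ} (a : Fin d → ℝ) : Fin d → ℝ :=
  fun i => a (-i)

/-- The circular convolution `(a * b)_k = ∑_j a_j b_{k - j}`, indices modulo `d`. -/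
def conv {d : ℕ} (a b : Fin d → ℝ) : Fin d → ℝ :=
  fun k => ∑ j, a j * b (k - j)

/-- The circulant completely positive cone: the convex cone generated by the autocorrelations
`v * v^R` of entrywise nonnegative vectors `v`. -/
def circCP (d : ℕ) : PointedCone ℝ (Fin d → ℝ) :=
  PointedCone.hull ℝ {a | ∃ v : Fin d → ℝ, (∀ i, 0 ≤ v i) ∧ a = conv v (reversal v)}

/-- The half-line `ℝ₊ v = {t v : t ≥ 0}`. -/
def ray {V : Type*} [AddCommGroup V] [Module ℝ V] (v : V) : Set V :=
  {x | ∃ t : ℝ, 0 ≤ t ∧ x = t • v}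

/-- The set of extremal rays of a convex cone `C`: the half-lines `ℝ₊ v ⊆ C` with `v ≠ 0` such that
`v = x + y` with `x, y ∈ C` forces `x, y ∈ ℝ₊ v`. -/
def extremalRays {V : Type*} [AddCommGroup V] [Module ℝ V] (C : Set V) : Set (Set V) :=
  {R | ∃ v : V, v ≠ 0 ∧ R = ray v ∧ ray v ⊆ C ∧
    ∀ x ∈ C, ∀ y ∈ C, v = x + y → x ∈ ray v ∧ y ∈ ray v}

/-- The vector `h_θ = (1, -cos θ, cos 2θ, cos 2θ, -cos θ)`. -/
noncomputable def h (θ : ℝ) : Fin 5 → ℝ :=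
  ![1, -Real.cos θ, Real.cos (2 * θ), Real.cos (2 * θ), -Real.cos θ]

/-- The vector `h'_θ = (1, cos 2θ, -cos θ, -cos θ, cos 2θ)`. -/
noncomputable def h' (θ : ℝ) : Fin 5 → ℝ :=
  ![1, Real.cos (2 * θ), -Real.cos θ, -Real.cos θ, Real.cos (2 * θ)]

/-- The Horn matrix. -/
def hornMatrix : Matrix (Fin 5) (Fin 5) ℝ :=
  !![ 1, -1,  1,  1, -1;
     -1,  1, -1,  1,  1;
      1, -1,  1, -1,  1;
      1,  1, -1,  1, -1;
     -1,  1,  1, -1,  1]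

end CircCone

namespace CircCone

/-! ### Duality -/

/-! Duality rests on the identity `dotProduct_circ_mulVec`: the quadratic form of `circ a` at `v` is
the pairing of `a` with the autocorrelation of `v`.

For the extremal rays, symmetry leaves three coordinates `(p, q, r)`, and the slice `p = 1` is a
planar region. The `h_θ` trace an arc of the parabola `r = 2q² - 1`, and the `h'_θ` its mirror
image. `horn_mem` places the arcs in the cone, and `tangent_nonneg` gives their tangent lines as
valid inequalities, whence extremality (`horn_extremal`). The inner ends of the arcs, at `cos
(π/5)`, lie on the line `1 + 2q + 2r = 0`, valid by the all-ones vector. So arcs and segment bound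
the slice from below; anything above differs by a nonnegative `(0, q, r)`, which gives completeness
(`exists_horn_le`). -/

theorem circ_isSymm_iff {d : ℕ} [NeZero d] (a : Fin d → ℝ) :
    (circ a).IsSymm ↔ reversal a = a := by
  constructor
  · intro hs
    funext i
    have := congrFun (congrFun hs 0) i
    simpa [circ, reversal, Matrix.transpose_apply] using this
  · intro hr
    ext i j
    have := congrFun hr (j - i)
    simpa [circ, reversal, Matrix.transpose_apply] using this

theorem dotProduct_circ_mulVec {d : ℕ} [NeZero d] (a v : Fin d → ℝ) :
    v ⬝ᵥ (circ a).mulVec v = a ⬝ᵥ conv v (reversal v) := by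
  simp only [dotProduct, Matrix.mulVec, circ, Matrix.of_apply, conv, reversal, Finset.mul_sum]
  rw [Finset.sum_comm, Finset.sum_comm (f := fun k j => a k * (v j * v (-(k - j))))]
  refine Finset.sum_congr rfl fun j _ => ?_
  -- For fixed `j`, substituting `k = j - i` turns the row index into the index of `a`.
  refine Fintype.sum_equiv (Equiv.subLeft j) _ _ fun i => ?_
  simp only [Equiv.subLeft_apply, neg_sub, sub_sub_cancel]
  ring

theorem mem_circCOP_iff {d : ℕ} [NeZero d] (a : Fin d → ℝ) :
    a ∈ circCOP d ↔
      reversal a = a ∧ ∀ v : Fin d → ℝ, (∀ i, 0 ≤ v i) → 0 ≤ v ⬝ᵥ (circ a).mulVec v := by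
  rw [← circ_isSymm_iff]
  exact ⟨fun ha => ha.2, fun ha => ⟨⟨a, rfl⟩, ha⟩⟩

/-- The circulant copositive cone is dual to the circulant completely positive cone. -/
theorem circCOP_eq_dual (d : ℕ) [NeZero d] :
    circCOP d = {a : Fin d → ℝ | reversal a = a ∧ ∀ x ∈ circCP d, 0 ≤ a ⬝ᵥ x} := by
  ext a
  rw [mem_circCOP_iff, Set.mem_ofPred_eq]
  refine and_congr_right fun _ => ⟨fun hv x hx => ?_, fun hx v hv => ?_⟩
  · induction hx using Submodule.span_induction with
    | mem x hx =>
      obtain ⟨v, hv0, rfl⟩ := hx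
      rw [← dotProduct_circ_mulVec]
      exact hv v hv0
    | zero => simp
    | add x y _ _ hx hy => rw [dotProduct_add]; exact add_nonneg hx hy
    | smul c x _ hx =>
      have : a ⬝ᵥ (c • x) = (c : ℝ) * (a ⬝ᵥ x) := dotProduct_smul (c : ℝ) a x
      rw [this]
      exact mul_nonneg c.2 hx
  · rw [dotProduct_circ_mulVec]
    exact hx _ (Submodule.subset_span ⟨v, hv, rfl⟩)

/-! ### Rays -/

section Rays

variable {V : Type*} [AddCommGroup V] [Module ℝ V]

theorem mem_ray_self (v : V) : v ∈ ray v := ⟨1, zero_le_one, (one_smul ℝ v).symm⟩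

theorem ray_eq_of_mem {v w : V} (hw : w ≠ 0) (hwv : w ∈ ray v) : ray v = ray w := by
  obtain ⟨t, ht, rfl⟩ := hwv
  have ht0 : t ≠ 0 := by rintro rfl; simp at hw
  ext x
  constructor
  · rintro ⟨s, hs, rfl⟩
    exact ⟨s / t, div_nonneg hs ht, by rw [smul_smul, div_mul_cancel₀ _ ht0]⟩
  · rintro ⟨s, hs, rfl⟩
    exact ⟨s * t, mul_nonneg hs ht, smul_smul s t v⟩

theorem ray_smul {v : V} (hv : v ≠ 0) {ε : ℝ} (hε : 0 < ε) : ray (ε • v) = ray v :=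
  (ray_eq_of_mem (smul_ne_zero hε.ne' hv) ⟨ε, hε.le, rfl⟩).symm

theorem ray_mem_extremalRays {C : Set V} {v : V} (hv : v ≠ 0) (hC : ray v ⊆ C)
    (hext : ∀ x ∈ C, ∀ y ∈ C, v = x + y → x ∈ ray v) : ray v ∈ extremalRays C :=
  ⟨v, hv, rfl, hC, fun x hx y hy hxy =>
    ⟨hext x hx y hy hxy, hext y hy x hx (by rw [hxy, add_comm])⟩⟩

/-- If every nonzero element of `C` dominates a positive multiple of an element of `G`, then every
extremal ray of `C` is spanned by an element of `G`. -/
theorem extremalRays_subset_of_dominates {C G : Set V} (h0 : ∀ w ∈ G, w ≠ 0)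
    (hdom : ∀ v ∈ C, v ≠ 0 → ∃ w ∈ G, ∃ ε : ℝ, 0 < ε ∧ ε • w ∈ C ∧ v - ε • w ∈ C) :
    extremalRays C ⊆ ray '' G := by
  rintro R ⟨v, hv, rfl, hC, hext⟩
  obtain ⟨w, hw, ε, hε, hwC, hsub⟩ := hdom v (hC (mem_ray_self v)) hv
  have hmem := (hext _ hwC _ hsub (add_sub_cancel _ _).symm).1
  exact ⟨w, hw, by
    rw [ray_eq_of_mem (smul_ne_zero hε.ne' (h0 w hw)) hmem, ray_smul (h0 w hw) hε]⟩

end Rays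

/-! ### Symmetric vectors of length five -/

/-- The symmetric vector `(p, q, r, r, q)`. -/
def symVec (p q r : ℝ) : Fin 5 → ℝ := ![p, q, r, r, q]

theorem symVec_add (p q r p' q' r' : ℝ) :
    symVec p q r + symVec p' q' r' = symVec (p + p') (q + q') (r + r') := by
  simp [symVec]

theorem symVec_sub (p q r p' q' r' : ℝ) :
    symVec p q r - symVec p' q' r' = symVec (p - p') (q - q') (r - r') := by
  simp [symVec]

theorem smul_symVec (t p q r : ℝ) : t • symVec p q r = symVec (t * p) (t * q) (t * r) := by
  simp [symVec]

theorem symVec_inj {p q r p' q' r' : ℝ} :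
    symVec p q r = symVec p' q' r' ↔ p = p' ∧ q = q' ∧ r = r' := by
  constructor
  · intro e
    exact ⟨congrFun e 0, congrFun e 1, congrFun e 2⟩
  · rintro ⟨rfl, rfl, rfl⟩
    rfl

theorem symVec_zero : symVec 0 0 0 = 0 := by
  ext i
  fin_cases i <;> rfl

theorem reversal_symVec (p q r : ℝ) : reversal (symVec p q r) = symVec p q r := by
  ext i
  fin_cases i <;> rfl

theorem exists_eq_symVec {a : Fin 5 → ℝ} (ha : a ∈ circCOP 5) :
    ∃ p q r, a = symVec p q r := by
  have hr := ((mem_circCOP_iff a).1 ha).1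
  have h3 : a 2 = a 3 := congrFun hr 3
  have h4 : a 1 = a 4 := congrFun hr 4
  refine ⟨a 0, a 1, a 2, ?_⟩
  ext i
  fin_cases i
  · rfl
  · rfl
  · rfl
  · exact h3.symm
  · exact h4.symm

theorem dotProduct_circ_symVec (p q r : ℝ) (x : Fin 5 → ℝ) :
    x ⬝ᵥ (circ (symVec p q r)).mulVec x =
      p * (x 0 ^ 2 + x 1 ^ 2 + x 2 ^ 2 + x 3 ^ 2 + x 4 ^ 2) +
        2 * q * (x 0 * x 1 + x 1 * x 2 + x 2 * x 3 + x 3 * x 4 + x 4 * x 0) +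
        2 * r * (x 0 * x 2 + x 1 * x 3 + x 2 * x 4 + x 3 * x 0 + x 4 * x 1) := by
  have e : circ (symVec p q r) =
      !![p, q, r, r, q; q, p, q, r, r; r, q, p, q, r; r, r, q, p, q; q, r, r, q, p] := by
    ext i j
    fin_cases i <;> fin_cases j <;> rfl
  rw [e]
  simp [dotProduct, Matrix.mulVec, Fin.sum_univ_five]
  ring

/-- The quadratic form of a symmetric circulant matrix of order five. -/
def form (p q r x₀ x₁ x₂ x₃ x₄ : ℝ) : ℝ :=
  p * (x₀ ^ 2 + x₁ ^ 2 + x₂ ^ 2 + x₃ ^ 2 + x₄ ^ 2) +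
    2 * q * (x₀ * x₁ + x₁ * x₂ + x₂ * x₃ + x₃ * x₄ + x₄ * x₀) +
    2 * r * (x₀ * x₂ + x₁ * x₃ + x₂ * x₄ + x₃ * x₀ + x₄ * x₁)

theorem symVec_mem_iff {p q r : ℝ} :
    symVec p q r ∈ circCOP 5 ↔
      ∀ x₀ x₁ x₂ x₃ x₄ : ℝ, 0 ≤ x₀ → 0 ≤ x₁ → 0 ≤ x₂ → 0 ≤ x₃ → 0 ≤ x₄ →
        0 ≤ form p q r x₀ x₁ x₂ x₃ x₄ := by
  rw [mem_circCOP_iff]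
  constructor
  · rintro ⟨-, H⟩ x₀ x₁ x₂ x₃ x₄ h₀ h₁ h₂ h₃ h₄
    have := H ![x₀, x₁, x₂, x₃, x₄] (by intro i; fin_cases i <;> assumption)
    rwa [dotProduct_circ_symVec] at this
  · refine fun H => ⟨reversal_symVec p q r, fun v hv => ?_⟩
    rw [dotProduct_circ_symVec]
    exact H _ _ _ _ _ (hv 0) (hv 1) (hv 2) (hv 3) (hv 4)

/-- Multiplication by 2 permutes the indices modulo 5 and exchanges the differences ±1 and ±2. -/
theorem symVec_swap_mem {p q r : ℝ} (H : symVec p q r ∈ circCOP 5) :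
    symVec p r q ∈ circCOP 5 := by
  rw [symVec_mem_iff] at H ⊢
  intro x₀ x₁ x₂ x₃ x₄ h₀ h₁ h₂ h₃ h₄
  have := H x₀ x₂ x₄ x₁ x₃ h₀ h₂ h₄ h₁ h₃
  unfold form at *
  linarith

theorem symVec_add_mem {p q r p' q' r' : ℝ} (H : symVec p q r ∈ circCOP 5)
    (H' : symVec p' q' r' ∈ circCOP 5) : symVec (p + p') (q + q') (r + r') ∈ circCOP 5 := by
  rw [symVec_mem_iff] at *
  intro x₀ x₁ x₂ x₃ x₄ h₀ h₁ h₂ h₃ h₄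
  have e := H x₀ x₁ x₂ x₃ x₄ h₀ h₁ h₂ h₃ h₄
  have e' := H' x₀ x₁ x₂ x₃ x₄ h₀ h₁ h₂ h₃ h₄
  unfold form at *
  linarith

theorem symVec_mul_mem {t p q r : ℝ} (ht : 0 ≤ t) (H : symVec p q r ∈ circCOP 5) :
    symVec (t * p) (t * q) (t * r) ∈ circCOP 5 := by
  rw [symVec_mem_iff] at *
  intro x₀ x₁ x₂ x₃ x₄ h₀ h₁ h₂ h₃ h₄
  have e := mul_nonneg ht (H x₀ x₁ x₂ x₃ x₄ h₀ h₁ h₂ h₃ h₄)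
  unfold form at *
  linarith

theorem ray_symVec_subset {p q r : ℝ} (H : symVec p q r ∈ circCOP 5) :
    ray (symVec p q r) ⊆ circCOP 5 := by
  rintro _ ⟨t, ht, rfl⟩
  rw [smul_symVec]
  exact symVec_mul_mem ht H

theorem symVec_mem_of_nonneg {q r : ℝ} (hq : 0 ≤ q) (hr : 0 ≤ r) :
    symVec 0 q r ∈ circCOP 5 := by
  rw [symVec_mem_iff]
  intro x₀ x₁ x₂ x₃ x₄ h₀ h₁ h₂ h₃ h₄
  unfold form
  positivity

/-! ### Necessary inequalities -/

theorem fst_nonneg {p q r : ℝ} (H : symVec p q r ∈ circCOP 5) : 0 ≤ p := by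
  have := symVec_mem_iff.1 H 1 0 0 0 0 (by simp) (by simp) (by simp) (by simp) (by simp)
  unfold form at this
  linarith

theorem fst_add_snd_nonneg {p q r : ℝ} (H : symVec p q r ∈ circCOP 5) : 0 ≤ p + q := by
  have := symVec_mem_iff.1 H 1 1 0 0 0 (by simp) (by simp) (by simp) (by simp) (by simp)
  unfold form at this
  linarith

/-- At `p = 1` the boundary line joins the inner ends of the two arcs. -/
theorem ones_nonneg {p q r : ℝ} (H : symVec p q r ∈ circCOP 5) : 0 ≤ p + 2 * q + 2 * r := by
  have := symVec_mem_iff.1 H 1 1 1 1 1 (by simp) (by simp) (by simp) (by simp) (by simp)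
  unfold form at this
  linarith

/-- The test vector `(1, 2t, 1, 0, 0)` is a zero of the form at `(1, -t, 2t² - 1)`. At `p = 1` the
boundary line is tangent to `r = 2q² - 1` at `q = -t`. -/
theorem tangent_nonneg {p q r t : ℝ} (H : symVec p q r ∈ circCOP 5) (ht : 0 ≤ t) :
    0 ≤ (1 + 2 * t ^ 2) * p + 4 * t * q + r := by
  have := symVec_mem_iff.1 H 1 (2 * t) 1 0 0 (by simp) (by positivity) (by simp) (by simp)
    (by simp)
  unfold form at this
  linarith

/-! ### The curve of Horn type -/

/-- Completing squares in `x₀` and then in `x₁` leaves a remainder with mixed products only. -/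
theorem form_horn_eq (t x₀ x₁ x₂ x₃ x₄ : ℝ) :
    form 1 (-t) (2 * t ^ 2 - 1) x₀ x₁ x₂ x₃ x₄ =
      (x₀ - t * x₁ + (2 * t ^ 2 - 1) * x₂ + (2 * t ^ 2 - 1) * x₃ - t * x₄) ^ 2 +
      (1 - t ^ 2) * (x₁ - 2 * t * x₂ - x₄ + 2 * t * x₃) ^ 2 +
      2 * (1 + t) * (4 * t ^ 2 - 2 * t - 1) *
        (x₁ * x₃ + x₂ * x₄ - (2 * t - 1) * (x₂ * x₃)) := by
  unfold form
  ring

theorem form_horn_nonneg_of_le {t x₀ x₁ x₂ x₃ x₄ : ℝ} (h0 : 0 ≤ t) (h1 : t ≤ 1)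
    (hg : 0 ≤ 4 * t ^ 2 - 2 * t - 1) (h₂ : 0 ≤ x₂) (h₃ : 0 ≤ x₃) (h₄ : 0 ≤ x₄) (hle : x₂ ≤ x₁) :
    0 ≤ form 1 (-t) (2 * t ^ 2 - 1) x₀ x₁ x₂ x₃ x₄ := by
  rw [form_horn_eq]
  have hs : 0 ≤ 1 - t ^ 2 := by nlinarith
  have hx : 0 ≤ x₁ * x₃ + x₂ * x₄ - (2 * t - 1) * (x₂ * x₃) := by
    have a1 : 0 ≤ (x₁ - x₂) * x₃ := mul_nonneg (by linarith) h₃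
    have a2 : 0 ≤ (1 - t) * (x₂ * x₃) := mul_nonneg (by linarith) (mul_nonneg h₂ h₃)
    have a3 := mul_nonneg h₂ h₄
    linarith
  positivity

theorem form_rotate (p q r x₀ x₁ x₂ x₃ x₄ : ℝ) :
    form p q r x₀ x₁ x₂ x₃ x₄ = form p q r x₁ x₂ x₃ x₄ x₀ := by
  unfold form
  ring

/-- Copositivity of the Horn type matrices. -/
theorem horn_mem {t : ℝ} (h0 : 0 ≤ t) (h1 : t ≤ 1) (hg : 0 ≤ 4 * t ^ 2 - 2 * t - 1) :
    symVec 1 (-t) (2 * t ^ 2 - 1) ∈ circCOP 5 := by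
  rw [symVec_mem_iff]
  intro x₀ x₁ x₂ x₃ x₄ h₀ h₁ h₂ h₃ h₄
  -- The entries cannot increase strictly all the way round the cycle, so some rotation satisfies
  -- the order hypothesis.
  by_cases c₁ : x₂ ≤ x₁
  · exact form_horn_nonneg_of_le h0 h1 hg h₂ h₃ h₄ c₁
  rw [form_rotate]
  by_cases c₂ : x₃ ≤ x₂
  · exact form_horn_nonneg_of_le h0 h1 hg h₃ h₄ h₀ c₂
  rw [form_rotate]
  by_cases c₃ : x₄ ≤ x₃
  · exact form_horn_nonneg_of_le h0 h1 hg h₄ h₀ h₁ c₃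
  rw [form_rotate]
  by_cases c₄ : x₀ ≤ x₄
  · exact form_horn_nonneg_of_le h0 h1 hg h₀ h₁ h₂ c₄
  rw [form_rotate]
  exact form_horn_nonneg_of_le h0 h1 hg h₁ h₂ h₃ (by linarith)

theorem cos_pi_div_five_pos : 0 < Real.cos (Real.pi / 5) := by
  rw [Real.cos_pi_div_five]
  positivity

/-- The coefficient `4t² - 2t - 1` in `form_horn_eq` changes sign here, which is where the arcs must
stop. -/
theorem cos_pi_div_five_quadratic :
    4 * Real.cos (Real.pi / 5) ^ 2 - 2 * Real.cos (Real.pi / 5) - 1 = 0 := by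
  rw [Real.cos_pi_div_five]
  have := Real.sq_sqrt (show (0 : ℝ) ≤ 5 by norm_num)
  linarith

theorem half_lt_cos_pi_div_five : 1 / 2 < Real.cos (Real.pi / 5) := by
  nlinarith [cos_pi_div_five_quadratic, cos_pi_div_five_pos]

theorem horn_mem_of_mem_Icc {t : ℝ} (ht : t ∈ Set.Icc (Real.cos (Real.pi / 5)) 1) :
    symVec 1 (-t) (2 * t ^ 2 - 1) ∈ circCOP 5 := by
  have hp := half_lt_cos_pi_div_five
  have hq := cos_pi_div_five_quadratic
  refine horn_mem (by linarith [ht.1]) ht.2 ?_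
  nlinarith [ht.1]

theorem cos_image_Icc :
    Real.cos '' Set.Icc 0 (Real.pi / 5) = Set.Icc (Real.cos (Real.pi / 5)) 1 := by
  have hpi := Real.pi_pos
  ext t
  constructor
  · rintro ⟨θ, ⟨h0, h1⟩, rfl⟩
    exact ⟨Real.cos_le_cos_of_nonneg_of_le_pi h0 (by linarith) h1, Real.cos_le_one θ⟩
  · rintro ⟨h0, h1⟩
    have hp := cos_pi_div_five_pos
    refine ⟨Real.arccos t, ⟨Real.arccos_nonneg t, ?_⟩, Real.cos_arccos (by linarith) h1⟩
    rw [← Real.arccos_cos (show 0 ≤ Real.pi / 5 by positivity) (by linarith)]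
    exact Real.arccos_le_arccos h0

theorem h_eq (θ : ℝ) : h θ = symVec 1 (-Real.cos θ) (2 * Real.cos θ ^ 2 - 1) := by
  simp [h, symVec, Real.cos_two_mul]

theorem h'_eq (θ : ℝ) : h' θ = symVec 1 (2 * Real.cos θ ^ 2 - 1) (-Real.cos θ) := by
  simp [h', symVec, Real.cos_two_mul]

theorem h_image : h '' Set.Icc 0 (Real.pi / 5) =
    (fun t => symVec 1 (-t) (2 * t ^ 2 - 1)) '' Set.Icc (Real.cos (Real.pi / 5)) 1 := by
  rw [← cos_image_Icc, Set.image_image]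
  exact Set.image_congr fun θ _ => h_eq θ

theorem h'_image : h' '' Set.Icc 0 (Real.pi / 5) =
    (fun t => symVec 1 (2 * t ^ 2 - 1) (-t)) '' Set.Icc (Real.cos (Real.pi / 5)) 1 := by
  rw [← cos_image_Icc, Set.image_image]
  exact Set.image_congr fun θ _ => h'_eq θ

/-! ### Extremality of the generators -/

theorem snd_extremal {p q r p' q' r' : ℝ} (H : symVec p q r ∈ circCOP 5)
    (H' : symVec p' q' r' ∈ circCOP 5) (hp : p + p' = 0) (hr : r + r' = 0) :
    0 ≤ q ∧ p = 0 ∧ r = 0 := by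
  have a1 := fst_nonneg H
  have a2 := fst_nonneg H'
  have a3 := fst_add_snd_nonneg (symVec_swap_mem H)
  have a4 := fst_add_snd_nonneg (symVec_swap_mem H')
  have a5 := fst_add_snd_nonneg H
  have p0 : p = 0 := by linarith
  exact ⟨by linarith, p0, by linarith⟩

/-- Both summands are nonnegative at the zero `(1, 2t, 1, 0, 0)` of their sum, so both vanish there.
Varying `t` gives a second linear equation, which fixes each summand up to scale. -/
theorem horn_extremal {t p q r p' q' r' : ℝ} (ht : t ∈ Set.Icc (Real.cos (Real.pi / 5)) 1)
    (H : symVec p q r ∈ circCOP 5) (H' : symVec p' q' r' ∈ circCOP 5) (hp : p + p' = 1)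
    (hq : q + q' = -t) (hr : r + r' = 2 * t ^ 2 - 1) :
    q = -(p * t) ∧ r = p * (2 * t ^ 2 - 1) := by
  have ht0 : 0 < t := cos_pi_div_five_pos.trans_le ht.1
  have hsum : ((1 + 2 * t ^ 2) * p + 4 * t * q + r) + ((1 + 2 * t ^ 2) * p' + 4 * t * q' + r') =
      0 := by
    linear_combination (1 + 2 * t ^ 2) * hp + 4 * t * hq + hr
  have hzero : (1 + 2 * t ^ 2) * p + 4 * t * q + r = 0 := by
    linarith [tangent_nonneg H ht0.le, tangent_nonneg H' ht0.le]
  suffices hqt : q = -(p * t) from ⟨hqt, by linear_combination hzero - 4 * t * hqt⟩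
  -- the tangent inequality is an equality at `t`, so its derivative in `t` vanishes
  have hmin : IsLocalMin (fun s : ℝ => (1 + 2 * s ^ 2) * p + 4 * s * q + r) t := by
    filter_upwards [lt_mem_nhds ht0] with s hs
    rw [hzero]
    exact tangent_nonneg H hs.le
  have hder : HasDerivAt (fun s : ℝ => (1 + 2 * s ^ 2) * p + 4 * s * q + r)
      (4 * t * p + 4 * q) t := by
    have h1 := ((((hasDerivAt_id t).pow 2).const_mul 2).const_add 1).mul_const p
    have h2 := ((hasDerivAt_id t).const_mul 4).mul_const q
    refine ((h1.add h2).add_const r).congr_deriv ?_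
    push_cast
    simp only [id]
    ring
  linarith [hmin.hasDerivAt_eq_zero hder]

/-- An extremality criterion for symmetric vectors, in coordinates. -/
theorem symVec_generator_extremal {p q r : ℝ} (hne : symVec p q r ≠ 0)
    (hmem : symVec p q r ∈ circCOP 5)
    (hext : ∀ a b c a' b' c', symVec a b c ∈ circCOP 5 → symVec a' b' c' ∈ circCOP 5 →
      a + a' = p → b + b' = q → c + c' = r →
      ∃ t, 0 ≤ t ∧ a = t * p ∧ b = t * q ∧ c = t * r) :
    ray (symVec p q r) ∈ extremalRays (circCOP 5) := by
  refine ray_mem_extremalRays hne (ray_symVec_subset hmem) fun x hx y hy hxy => ?_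
  obtain ⟨a, b, c, rfl⟩ := exists_eq_symVec hx
  obtain ⟨a', b', c', rfl⟩ := exists_eq_symVec hy
  rw [symVec_add, symVec_inj] at hxy
  obtain ⟨h1, h2, h3⟩ := hxy
  obtain ⟨t, ht, e⟩ := hext a b c a' b' c' hx hy h1.symm h2.symm h3.symm
  exact ⟨t, ht, by rw [smul_symVec, symVec_inj]; exact e⟩

theorem symVec_ne_zero {p q r : ℝ} (hne : p ≠ 0 ∨ q ≠ 0 ∨ r ≠ 0) : symVec p q r ≠ 0 := by
  rw [← symVec_zero, Ne, symVec_inj]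
  tauto

theorem ray_snd_mem : ray (symVec 0 1 0) ∈ extremalRays (circCOP 5) := by
  refine symVec_generator_extremal (symVec_ne_zero (by simp))
    (symVec_mem_of_nonneg zero_le_one le_rfl) fun a b c a' b' c' H H' h1 h2 h3 => ?_
  obtain ⟨hb, ha, hc⟩ := snd_extremal H H' h1 h3
  exact ⟨b, hb, by simpa using ha, by simp, by simpa using hc⟩

theorem ray_trd_mem : ray (symVec 0 0 1) ∈ extremalRays (circCOP 5) := by
  refine symVec_generator_extremal (symVec_ne_zero (by simp))
    (symVec_mem_of_nonneg le_rfl zero_le_one) fun a b c a' b' c' H H' h1 h2 h3 => ?_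
  obtain ⟨hc, ha, hb⟩ := snd_extremal (symVec_swap_mem H) (symVec_swap_mem H') h1 h2
  exact ⟨c, hc, by simpa using ha, by simpa using hb, by simp⟩

theorem ray_horn_mem {t : ℝ} (ht : t ∈ Set.Icc (Real.cos (Real.pi / 5)) 1) :
    ray (symVec 1 (-t) (2 * t ^ 2 - 1)) ∈ extremalRays (circCOP 5) := by
  refine symVec_generator_extremal (symVec_ne_zero (by simp))
    (horn_mem_of_mem_Icc ht) fun a b c a' b' c' H H' h1 h2 h3 => ?_
  obtain ⟨hb, hc⟩ := horn_extremal ht H H' h1 h2 h3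
  exact ⟨a, fst_nonneg H, by simp, by simpa using hb, hc⟩

theorem ray_horn_swap_mem {t : ℝ} (ht : t ∈ Set.Icc (Real.cos (Real.pi / 5)) 1) :
    ray (symVec 1 (2 * t ^ 2 - 1) (-t)) ∈ extremalRays (circCOP 5) := by
  refine symVec_generator_extremal (symVec_ne_zero (by simp))
    (symVec_swap_mem (horn_mem_of_mem_Icc ht)) fun a b c a' b' c' H H' h1 h2 h3 => ?_
  obtain ⟨hc, hb⟩ := horn_extremal ht (symVec_swap_mem H) (symVec_swap_mem H') h1 h3 h2
  exact ⟨a, fst_nonneg H, by simp, hb, by simpa using hc⟩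

/-! ### Completeness of the list -/

/-- The proposed generators, with the two curves parametrized by the cosine. -/
def generators : Set (Fin 5 → ℝ) :=
  {symVec 0 1 0, symVec 0 0 1} ∪
    (fun t => symVec 1 (-t) (2 * t ^ 2 - 1)) '' Set.Icc (Real.cos (Real.pi / 5)) 1 ∪
    (fun t => symVec 1 (2 * t ^ 2 - 1) (-t)) '' Set.Icc (Real.cos (Real.pi / 5)) 1

/-- Every element of the cone with first entry `1` dominates a positive multiple of an element of one
of the two curves. -/
theorem exists_horn_le {q r : ℝ} (H : symVec 1 q r ∈ circCOP 5) :
    ∃ t ∈ Set.Icc (Real.cos (Real.pi / 5)) 1, ∃ ε, 0 < ε ∧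
      (symVec (1 - ε) (q + ε * t) (r - ε * (2 * t ^ 2 - 1)) ∈ circCOP 5 ∨
        symVec (1 - ε) (q - ε * (2 * t ^ 2 - 1)) (r + ε * t) ∈ circCOP 5) := by
  have hg := half_lt_cos_pi_div_five
  have hg2 := cos_pi_div_five_quadratic
  set g := Real.cos (Real.pi / 5)
  have hg1 : g ≤ 1 := Real.cos_le_one _
  have H' := symVec_swap_mem H
  have hq1 := fst_add_snd_nonneg H
  have hr1 := fst_add_snd_nonneg H'
  have hones := ones_nonneg H
  by_cases cq : q ≤ -g
  -- The tangent at the point of the arc with the same `q` gives `r ≥ 2q² - 1`.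
  · have := tangent_nonneg H (show 0 ≤ -q by linarith)
    refine ⟨-q, ⟨by linarith, by linarith⟩, 1, one_pos, Or.inl ?_⟩
    convert symVec_mem_of_nonneg (le_refl 0) (show 0 ≤ r - (2 * q ^ 2 - 1) by nlinarith) using 2 <;>
      ring
  by_cases cr : r ≤ -g
  · have := tangent_nonneg H' (show 0 ≤ -r by linarith)
    refine ⟨-r, ⟨by linarith, by linarith⟩, 1, one_pos, Or.inr ?_⟩
    convert symVec_mem_of_nonneg (show 0 ≤ q - (2 * r ^ 2 - 1) by nlinarith) (le_refl 0) using 2 <;>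
      ring
  push Not at cq cr
  have hgm : g ∈ Set.Icc g 1 := ⟨le_rfl, hg1⟩
  -- The quadratic for `g` gives `2g² - 1 = g - 1/2`, so the arcs end at `(-g, g - 1/2)` and `(g -
  -- 1/2, -g)`.
  by_cases cm : g - 1 / 2 ≤ q
  · refine ⟨g, hgm, 1, one_pos, Or.inr ?_⟩
    convert symVec_mem_of_nonneg (show 0 ≤ q - (2 * g ^ 2 - 1) by linarith)
      (show 0 ≤ r + g by linarith) using 2 <;> ring
  · -- on the segment between the two curves, or above it
    push Not at cm
    have hd : 0 < 2 * g - 1 / 2 := by linarith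
    -- `l` is the weight of the end `(-g, g - 1/2)` in the point of the segment with abscissa `q`;
    -- `l < 1` because `q > -g`, so the other end has positive weight.
    obtain ⟨l, hl⟩ : ∃ l, l * (2 * g - 1 / 2) = g - 1 / 2 - q :=
      ⟨_, div_mul_cancel₀ _ hd.ne'⟩
    have hl0 : 0 ≤ l := by
      by_contra hneg
      push Not at hneg
      nlinarith
    have hl1 : l < 1 := by
      by_contra hneg
      push Not at hneg
      nlinarith
    refine ⟨g, hgm, 1 - l, by linarith, Or.inr ?_⟩
    convert symVec_add_mem (symVec_mul_mem hl0 (horn_mem_of_mem_Icc hgm))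
      (symVec_mem_of_nonneg (le_refl 0) (show 0 ≤ 1 / 2 + q + r by linarith)) using 2
    · ring
    · linear_combination hl - (1 - l) * hg2 / 2
    · linear_combination -hl - l * hg2 / 2

theorem generators_ne_zero {w : Fin 5 → ℝ} (hw : w ∈ generators) : w ≠ 0 := by
  rcases hw with ((rfl | rfl) | ⟨t, -, rfl⟩) | ⟨t, -, rfl⟩ <;> exact symVec_ne_zero (by simp)

theorem generators_dominate {v : Fin 5 → ℝ} (hv : v ∈ circCOP 5) (hv0 : v ≠ 0) :
    ∃ w ∈ generators, ∃ ε : ℝ, 0 < ε ∧ ε • w ∈ circCOP 5 ∧ v - ε • w ∈ circCOP 5 := by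
  obtain ⟨p, q, r, rfl⟩ := exists_eq_symVec hv
  have hp := fst_nonneg hv
  have hpq := fst_add_snd_nonneg hv
  have hpr := fst_add_snd_nonneg (symVec_swap_mem hv)
  have key : ∀ {ε a b c : ℝ}, 0 < ε → symVec a b c ∈ generators → symVec a b c ∈ circCOP 5 →
      symVec (p - ε * a) (q - ε * b) (r - ε * c) ∈ circCOP 5 →
      ∃ w ∈ generators, ∃ ε : ℝ, 0 < ε ∧ ε • w ∈ circCOP 5 ∧
        symVec p q r - ε • w ∈ circCOP 5 := by
    intro ε a b c hε hG hC hsub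
    refine ⟨_, hG, ε, hε, ?_, ?_⟩
    · rw [smul_symVec]
      exact symVec_mul_mem hε.le hC
    · rw [smul_symVec, symVec_sub]
      exact hsub
  rcases hp.eq_or_lt with rfl | hp
  · have hq : 0 ≤ q := by linarith
    have hr : 0 ≤ r := by linarith
    rcases hq.eq_or_lt with rfl | hq
    · rcases hr.eq_or_lt with rfl | hr
      · exact absurd symVec_zero hv0
      · refine key hr (a := 0) (b := 0) (c := 1) (Or.inl (Or.inl (Or.inr rfl)))
          (symVec_mem_of_nonneg le_rfl zero_le_one) ?_
        convert symVec_mem_of_nonneg (le_refl 0) (le_refl 0) using 2 <;> ring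
    · refine key hq (a := 0) (b := 1) (c := 0) (Or.inl (Or.inl (Or.inl rfl)))
        (symVec_mem_of_nonneg zero_le_one le_rfl) ?_
      convert symVec_mem_of_nonneg (le_refl 0) hr using 2 <;> ring
  · have H : symVec 1 (p⁻¹ * q) (p⁻¹ * r) ∈ circCOP 5 := by
      have := symVec_mul_mem (inv_nonneg.2 hp.le) hv
      rwa [inv_mul_cancel₀ hp.ne'] at this
    obtain ⟨t, ht, ε, hε, hd | hd⟩ := exists_horn_le H
    · refine key (mul_pos hp hε) (Or.inl (Or.inr ⟨t, ht, rfl⟩)) (horn_mem_of_mem_Icc ht) ?_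
      convert symVec_mul_mem hp.le hd using 2 <;> field_simp
      ring
    · refine key (mul_pos hp hε) (Or.inr ⟨t, ht, rfl⟩)
        (symVec_swap_mem (horn_mem_of_mem_Icc ht)) ?_
      convert symVec_mul_mem hp.le hd using 2 <;> field_simp
      ring

/-- The extremal rays of the circulant copositive cone of order five. -/
theorem extremalRays_circCOP_five : extremalRays (circCOP 5) = ray '' generators := by
  refine (extremalRays_subset_of_dominates (fun _ => generators_ne_zero)
    fun _ => generators_dominate).antisymm ?_
  rintro _ ⟨w, ((rfl | rfl) | ⟨t, ht, rfl⟩) | ⟨t, ht, rfl⟩, rfl⟩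
  · exact ray_snd_mem
  · exact ray_trd_mem
  · exact ray_horn_mem ht
  · exact ray_horn_swap_mem ht

/-! ### Disjointness and the Horn matrix -/

theorem disjoint_of_apply_zero {S T : Set (Fin 5 → ℝ)} (hS : ∀ v ∈ S, v 0 = 0)
    (hT : ∀ v ∈ T, v 0 = 1) : Disjoint S T :=
  Set.disjoint_left.2 fun v hvS hvT => zero_ne_one ((hS v hvS).symm.trans (hT v hvT))

theorem disjoint_h_h' :
    Disjoint (h '' Set.Icc 0 (Real.pi / 5)) (h' '' Set.Icc 0 (Real.pi / 5)) := by
  rw [h_image, h'_image, Set.disjoint_left]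
  rintro _ ⟨t, ht, rfl⟩ ⟨s, hs, e⟩
  have e2 := (symVec_inj.1 e).2.1
  have hg := half_lt_cos_pi_div_five
  have hg2 := cos_pi_div_five_quadratic
  -- The second entries have opposite signs: `-t < 0`, while `2s² - 1 ≥ g - 1/2 > 0` with `g = cos
  -- (π/5)`.
  nlinarith [ht.1, hs.1]

theorem circ_h_zero : circ (h 0) = hornMatrix := by
  ext i j
  fin_cases i <;> fin_cases j <;> simp [circ, h, hornMatrix]

end CircCone

theorem mainTheorem4 :
    -- the circulant copositive cone is the dual, among symmetric vectors, of the circulant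
    -- completely positive cone
    CircCone.circCOP 5 =
        {a : Fin 5 → ℝ | CircCone.reversal a = a ∧ ∀ x ∈ CircCone.circCP 5, 0 ≤ a ⬝ᵥ x} ∧
    -- the complete list of its extremal rays
    CircCone.extremalRays (CircCone.circCOP 5) =
        CircCone.ray ''
          (({![0, 1, 0, 0, 1], ![0, 0, 1, 1, 0]} : Set (Fin 5 → ℝ)) ∪
            CircCone.h '' Set.Icc 0 (Real.pi / 5) ∪
            CircCone.h' '' Set.Icc 0 (Real.pi / 5)) ∧
    -- the three sets of generators are pairwise disjoint
    Disjoint ({![0, 1, 0, 0, 1], ![0, 0, 1, 1, 0]} : Set (Fin 5 → ℝ))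
        (CircCone.h '' Set.Icc 0 (Real.pi / 5)) ∧
    Disjoint ({![0, 1, 0, 0, 1], ![0, 0, 1, 1, 0]} : Set (Fin 5 → ℝ))
        (CircCone.h' '' Set.Icc 0 (Real.pi / 5)) ∧
    Disjoint (CircCone.h '' Set.Icc 0 (Real.pi / 5))
        (CircCone.h' '' Set.Icc 0 (Real.pi / 5)) ∧
    -- the Horn matrix is the member `θ = 0` of the first family
    CircCone.circ (CircCone.h 0) = CircCone.hornMatrix := by
  have hpair : ∀ v ∈ ({![0, 1, 0, 0, 1], ![0, 0, 1, 1, 0]} : Set (Fin 5 → ℝ)), v 0 = 0 := by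
    rintro _ (rfl | rfl) <;> rfl
  refine ⟨CircCone.circCOP_eq_dual 5, ?_, ?_, ?_, CircCone.disjoint_h_h', CircCone.circ_h_zero⟩
  · rw [CircCone.h_image, CircCone.h'_image]
    exact CircCone.extremalRays_circCOP_five
  · exact CircCone.disjoint_of_apply_zero hpair (by rintro _ ⟨θ, -, rfl⟩; rfl)
  · exact CircCone.disjoint_of_apply_zero hpair (by rintro _ ⟨θ, -, rfl⟩; rfl)
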